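/- **Setting.** Let $(\Omega,\mathcal F,P)$ be a probability space and $(B,\rho)$ a non-empty compact (pseudo)metric space. Let $\varphi\in C_I$ with exponent $\zeta\ge 2$: $\varphi:\mathbb R\to\mathbb R$ is even, convex and continuous, $\varphi(0)=0$, $\varphi(x)>0$ for $x\ne0$, $\varphi(x)/x\to0$ as $x\to0$, $\varphi(x)/x\to\infty$ as $x\to\infty$, $\lim_{x\to0}\varphi(x)/x^2$ exists in $(0,\infty]$, and $\varphi(t)=t^\zeta/\zeta$ for $t>1$. A random variable $\xi$ belongs to $\mathrm{Sub}_\varphi(\Omega)$ if for some $a\ge0$ one has $E\exp(\lambda\xi)\le\exp(\varphi(a\lambda))$ for all $\lambda\in\mathbb R$; $\tau_\varphi(\xi)$ is the infimum of such $a$. A process belongs to $\mathrm{Sub}_\varphi(\Omega)$ if all its values do. For $u>0$ let $N_B(u)$ be the least number of closed balls of radius $u$ covering $B$ (so $N_B(\infty)=1$). A *modulus* is a continuous monotone increasing function $\sigma(h)$, $h>0$, with $\sigma(h)\to0$ as $h\to0$ (put $\sigma(0)=0$); $\sigma^{(-1)}(u)=\sup\{h\ge0:\sigma(h)\le u\}\in[0,\infty]$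 is its inverse, equal to $\infty$ for $u$ above its range. Let $r$ be a continuous strictly increasing function on $[1,\infty)$ with $r(u)>0$ for $u>1$ such that $t\mapsto r(e^t)$ is convex on $(0,\infty)$, and let $r^{(-1)}$ be its inverse. Let $X=\{X(t),t\in B\}$ be a separable process from $\mathrm{Sub}_\varphi(\Omega)$ and $\sigma$ a modulus with $\sup_{\rho(t,s)\le h}\tau_\varphi(X(t)-X(s))\le\sigma(h)$ for all $h>0$. Put $\beta=\sigma\big(\inf_{s\in B}\sup_{t\in B}\rho(t,s)\big)$ and assume $\beta>0$ and $\int_0^{\beta}r(N_B(\sigma^{(-1)}(u)))\,du<\infty$. Suppose that $X(t)=\sum_{k=0}^\infty\xi_k a_k(t)$ for each $t\in B$, where $\xi_k$ are random variables, $a_k:B\to\mathbb R$ are functions and the series converges in mean square. Let the model $X_N(t)=\sum_{k=0}^N\xi_ka_k(t)$ belong to $\mathrm{Sub}_\varphi(\Omega)$, put $\Delta_N=X-X_N$, and let $\sigma_N$ be a modulus with $\sup_{\rho(t,s)\le h}\tau_\varphi(\Delta_N(t)-\Delta_N(s))\le\sigma_N(h)$ for all $h>0$. Put $\gamma_N=\sup_{u\in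 B}\tau_\varphi(\Delta_N(u))$, and let $p\in(0,1)$ be such that $\int_0^{\beta p}r(N_B(\sigma_N^{(-1)}(u)))\,du<\infty$. **Theorem 4.** Let $\nu,\delta$ be real numbers such that $$\nu\ \ge\ 2\exp\left\{-\frac{(\zeta-1)\,(\delta(1-p))^{\frac{\zeta}{\zeta-1}}}{\zeta\,\big(\gamma_N^\zeta(1-p)+p\beta^\zeta\big)^{\frac1{\zeta-1}}}\right\}\; r^{(-1)}\!\left(\frac1{\beta p}\int_0^{\beta p}r\big(N_B(\sigma_N^{(-1)}(u))\big)\,du\right)$$ and $$\delta\ >\ \frac{\gamma_N^\zeta(1-p)+p\beta^\zeta}{(1-p)\,v^{\zeta-1}},\qquad v=\min\{\beta,\gamma_N\}$$ (for $v=0$ the right-hand side is read as $0$). Then the model $X_N$ approximates $X$ with reliability $1-\nu$ and accuracy $\delta$ in $C(B)$, that is, $$P\Big\{\sup_{t\in B}|X(t)-X_N(t)|>\delta\Big\}\le\nu .$$ -/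

import Mathlib

open Set Filter Topology MeasureTheory
open scoped NNReal ENNReal

noncomputable section

namespace PhiSub

/-! ### Orlicz N-functions and the class of power-type N-functions -/

/-- An Orlicz N-function: an even, convex, continuous function, zero only at `0`, with
`φ x / x → 0` as `x → 0` and `φ x / x → ∞` as `x → ∞`. -/
structure IsOrliczN (φ : ℝ → ℝ) : Prop where
  even : ∀ x, φ (-x) = φ x
  convex : ConvexOn ℝ univ φ
  continuous : Continuous φ
  map_zero : φ 0 = 0
  pos : ∀ x, x ≠ 0 → 0 < φ x
  tendsto_zero : Tendsto (fun x => φ x / x) (𝓝[≠] 0) (𝓝 0)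
  tendsto_atTop : Tendsto (fun x => φ x / x) atTop atTop

/-- An N-function with `φ x / x ^ 2 → c` as `x → 0` for some `c ∈ (0, ∞]`. -/
structure AssumptionQ (φ : ℝ → ℝ) : Prop extends IsOrliczN φ where
  quadratic : ∃ c : ℝ≥0∞, 0 < c ∧
    Tendsto (fun x => ENNReal.ofReal (φ x / x ^ 2)) (𝓝[≠] 0) (𝓝 c)

/-- The class `C_I`, with exponent `ζ`: `ζ ≥ 2` and `φ t = t ^ ζ / ζ` for `t > 1`
(nothing is said about `|t| < 1` beyond the N-function axioms and assumption Q). -/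
structure ClassI (ζ : ℝ) (φ : ℝ → ℝ) : Prop extends AssumptionQ φ where
  two_le : 2 ≤ ζ
  eq_rpow : ∀ t, 1 < t → φ t = t ^ ζ / ζ

/-! ### `φ`-sub-Gaussian random variables and processes -/

section Prob

variable {Ω : Type*} [MeasurableSpace Ω]

/-- `E exp (l ξ) ≤ exp (φ (a l))` for all real `l`. -/
def ExpBound (φ : ℝ → ℝ) (μ : Measure Ω) (ξ : Ω → ℝ) (a : ℝ) : Prop :=
  ∀ l : ℝ, ∫⁻ ω, ENNReal.ofReal (Real.exp (l * ξ ω)) ∂μ ≤ ENNReal.ofReal (Real.exp (φ (a * l)))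

/-- Membership in `Sub_φ(Ω)`. -/
def IsSub (φ : ℝ → ℝ) (μ : Measure Ω) (ξ : Ω → ℝ) : Prop :=
  AEMeasurable ξ μ ∧ ∃ a : ℝ, 0 ≤ a ∧ ExpBound φ μ ξ a

/-- The `φ`-sub-Gaussian standard `τ_φ(ξ)`. -/
def tau (φ : ℝ → ℝ) (μ : Measure Ω) (ξ : Ω → ℝ) : ℝ :=
  sInf {a : ℝ | 0 ≤ a ∧ ExpBound φ μ ξ a}

/-- A `φ`-sub-Gaussian process: every `X t` belongs to `Sub_φ(Ω)`. -/
def IsSubProcess {B : Type*} (φ : ℝ → ℝ) (μ : Measure Ω) (X : B → Ω → ℝ) : Prop :=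
  ∀ t, IsSub φ μ (X t)

/-- Separability of a real process: there are a countable dense `S ⊆ B` and a null set outside
which, for all open `G ⊆ B` and closed `F ⊆ ℝ`, if `X s ∈ F` for all `s ∈ G ∩ S`, then
`X t ∈ F` for all `t ∈ G`. -/
def IsSeparableProcess {B : Type*} [TopologicalSpace B] (μ : Measure Ω) (X : B → Ω → ℝ) : Prop :=
  ∃ S : Set B, S.Countable ∧ Dense S ∧ ∀ᵐ ω ∂μ, ∀ (G : Set B) (F : Set ℝ), IsOpen G → IsClosed F →
    (∀ s ∈ G ∩ S, X s ω ∈ F) → ∀ t ∈ G, X t ω ∈ F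

end Prob

/-! ### Moduli and metric massiveness -/

/-- A continuous monotone increasing function `σ` of `h > 0` with `σ h → 0` as `h → 0`,
extended by `σ 0 = 0` (so that continuity on `[0, ∞)` holds the limit at `0`). -/
structure IsModulus (σ : ℝ → ℝ) : Prop where
  map_zero : σ 0 = 0
  continuousOn : ContinuousOn σ (Ici 0)
  monotoneOn : MonotoneOn σ (Ici 0)

/-- The inverse `σ⁻¹ u = sup {h ≥ 0 : σ h ≤ u}`. For a strictly increasing modulus this is the
usual inverse on the range of `σ`, and it is `∞` for `u` above the range. -/
def modInv (σ : ℝ → ℝ) (u : ℝ) : ℝ≥0∞ :=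
  ⨆ (h : ℝ≥0) (_ : σ h ≤ u), (h : ℝ≥0∞)

/-- Metric massiveness `N_B(u)`: the least number of closed balls of radius `u` that cover `B`. -/
def massiveness (B : Type*) [PseudoMetricSpace B] (u : ℝ≥0∞) : ℕ :=
  sInf {n : ℕ | ∃ C : Finset B, C.card = n ∧ ∀ x : B, ∃ c ∈ C, edist x c ≤ u}

/-- `inf_{s ∈ B} sup_{t ∈ B} ρ(t, s)`. -/
def chebyshevRadius (B : Type*) [PseudoMetricSpace B] : ℝ :=
  ⨅ s : B, ⨆ t : B, dist t s

/-- The function `u ↦ r (N_B(σ⁻¹ u))`. -/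
def entropyFun (B : Type*) [PseudoMetricSpace B] (r σ : ℝ → ℝ) (u : ℝ) : ℝ :=
  r (massiveness B (modInv σ u))

/-- Admissible `r` on `[1, ∞)`: continuous, strictly increasing (so that `r⁻¹` makes sense),
positive on `(1, ∞)`, with `t ↦ r (exp t)` convex on `(0, ∞)`. -/
structure IsEntropyWeight (r : ℝ → ℝ) : Prop where
  continuousOn : ContinuousOn r (Ici 1)
  strictMonoOn : StrictMonoOn r (Ici 1)
  pos : ∀ u, 1 < u → 0 < r u
  convexOn : ConvexOn ℝ (Ioi 0) (fun t => r (Real.exp t))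

/-- The inverse of `r : [1, ∞) → ℝ`. -/
def weightInv (r : ℝ → ℝ) (y : ℝ) : ℝ :=
  Function.invFunOn r (Ici 1) y

section Model

variable {Ω B : Type*} [MeasurableSpace Ω] [PseudoMetricSpace B]

/-- `sup_{ρ(t,s) ≤ h} τ_φ(X t - X s) ≤ σ h` for all `h > 0`. -/
def IncrementBound (φ : ℝ → ℝ) (μ : Measure Ω) (X : B → Ω → ℝ) (σ : ℝ → ℝ) : Prop :=
  ∀ h : ℝ, 0 < h → ∀ t s : B, dist t s ≤ h → tau φ μ (fun ω => X t ω - X s ω) ≤ σ h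

/-- The hypotheses of the entropy bound for the process `X` with modulus `σ` and weight `r`,
where `β = σ (inf_s sup_t ρ(t, s))`. -/
structure EntropyConditions (φ : ℝ → ℝ) (μ : Measure Ω) (X : B → Ω → ℝ) (σ r : ℝ → ℝ)
    (β : ℝ) : Prop where
  sub : IsSubProcess φ μ X
  separable : IsSeparableProcess μ X
  modulus : IsModulus σ
  increments : IncrementBound φ μ X σ
  weight : IsEntropyWeight r
  beta_eq : β = σ (chebyshevRadius B)
  beta_pos : 0 < β
  integrable : IntegrableOn (entropyFun B r σ) (Ioo 0 β)

/-- `XN` is the model of `X`: `X t = ∑ ξ_k a_k(t)`, a mean square convergent series of random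
variables times deterministic functions, and `XN t = ∑_{k = 0}^N ξ_k a_k(t)`. -/
def IsModel (μ : Measure Ω) (N : ℕ) (X XN : B → Ω → ℝ) : Prop :=
  ∃ (ξ : ℕ → Ω → ℝ) (a : ℕ → B → ℝ), (∀ k, AEMeasurable (ξ k) μ) ∧
    (∀ t, Tendsto
      (fun n => eLpNorm (fun ω => X t ω - ∑ k ∈ Finset.range n, ξ k ω * a k t) 2 μ)
      atTop (𝓝 0)) ∧
    ∀ t ω, XN t ω = ∑ k ∈ Finset.range (N + 1), ξ k ω * a k t

/-- `XN` approximates `X` with reliability `1 - ν` and accuracy `δ` in `C(B)`: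
`P (sup_t |X t - XN t| > δ) ≤ ν`. The supremum is taken in `[0, ∞]`. -/
def Approximates (μ : Measure Ω) (X XN : B → Ω → ℝ) (ν δ : ℝ) : Prop :=
  μ {ω | ENNReal.ofReal δ < ⨆ t : B, ‖X t ω - XN t ω‖ₑ} ≤ ENNReal.ofReal ν

end Model

/-- The bound
`exp (-(ζ-1) (x(1-p))^(ζ/(ζ-1)) / (ζ (γ^ζ (1-p) + p β^ζ)^(1/(ζ-1))))
  * r⁻¹ ((1/(βp)) ∫_0^{βp} r (N_B(σ⁻¹ u)) du)`. -/
def tailBound (B : Type*) [PseudoMetricSpace B] (r σ : ℝ → ℝ) (ζ γ β p x : ℝ) : ℝ :=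
  Real.exp (-((ζ - 1) * (x * (1 - p)) ^ (ζ / (ζ - 1)) /
      (ζ * (γ ^ ζ * (1 - p) + p * β ^ ζ) ^ (1 / (ζ - 1))))) *
    weightInv r (1 / (β * p) * ∫ u in Ioo 0 (β * p), entropyFun B r σ u)

end PhiSub

end

open PhiSub

namespace PhiSub

/-! Write `Y` for the error `X - XN`. Three ideas are combined.

Chaining with Hölder weights. Take nets of `B` whose mesh makes the `σN`-increment at most `β p · p
^ k`, and end the chain in an arbitrary finite set `F`. The exponential of `l |Y|` is dominated by a
product of one factor per level, and Hölder's inequality with weights `(1 - p) p ^ k` and a last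
weight `p ^ m` separates the levels (`chaining_tail`). The weights match the decay of the
increments, so every level after the first contributes the same value `φ (β x)`. The last set costs
`F.card ^ (p ^ m)`, which tends to `1` as `m → ∞`; hence the bound does not depend on `F` and passes
to countable sets (`entropy_tail`). Jensen's inequality for `r ∘ exp` and a comparison of a
geometric sum with an integral turn the net sizes into the entropy integral.

Choice of the free parameter. For power-type `φ` the exponent is `A x ^ ζ / ζ - D x`; it is
minimised at `x = (D / A) ^ (1 / (ζ - 1))`. The lower bound on `δ` is exactly what places `γN x` and
`β x` in the range where `φ` is a power (`exists_optimal_scale`).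

Reduction to a countable set. Only `X` is assumed separable. The model is a finite sum that is
continuous in `L¹`, so its paths are almost surely continuous (`ae_continuous_of_finite_sum`), and
the supremum of the error is then controlled on the separating set of `X`. -/

theorem IsOrliczN.le_of_abs_le {φ : ℝ → ℝ} (hφ : IsOrliczN φ) {x y : ℝ} (h : |x| ≤ |y|) :
    φ x ≤ φ y := by
  have habs : ∀ z, φ |z| = φ z := fun z => by
    rcases abs_choice z with hz | hz <;> simp [hz, hφ.even]
  have hnn : ∀ z, 0 ≤ φ z := fun z => by
    rcases eq_or_ne z 0 with rfl | hz
    · exact hφ.map_zero.ge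
    · exact (hφ.pos z hz).le
  rw [← habs x, ← habs y]
  rcases (abs_nonneg y).eq_or_lt with hy | hy
  · rw [← hy] at h ⊢
    rw [le_antisymm h (abs_nonneg x)]
  have hq : |x| / |y| ≤ 1 := (div_le_one hy).2 h
  have hq0 : 0 ≤ |x| / |y| := by positivity
  have := hφ.convex.2 (mem_univ 0) (mem_univ |y|) (sub_nonneg.2 hq) hq0 (by ring)
  simp only [smul_eq_mul, mul_zero, zero_add, hφ.map_zero, div_mul_cancel₀ _ hy.ne'] at this
  exact this.trans (mul_le_of_le_one_left (hnn _) hq)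

/-! ### Calculus of `φ`-sub-Gaussian variables. -/

section SubGaussian

variable {Ω : Type*} [MeasurableSpace Ω] {μ : Measure Ω} {φ : ℝ → ℝ} {ξ η : Ω → ℝ} {a b : ℝ}

theorem ExpBound.mono (hφ : IsOrliczN φ) (h : ExpBound φ μ ξ a) (ha : 0 ≤ a) (hab : a ≤ b) :
    ExpBound φ μ ξ b := fun l => (h l).trans <| by
  gcongr
  apply hφ.le_of_abs_le
  rw [abs_mul, abs_mul, abs_of_nonneg ha, abs_of_nonneg (ha.trans hab)]
  gcongr

theorem ExpBound.of_forall_gt (hφ : IsOrliczN φ) (h : ∀ b, a < b → ExpBound φ μ ξ b) :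
    ExpBound φ μ ξ a := fun l => by
  have hc := hφ.continuous
  have : Tendsto (fun b => ENNReal.ofReal (Real.exp (φ (b * l)))) (𝓝[>] a)
      (𝓝 (ENNReal.ofReal (Real.exp (φ (a * l))))) := by
    have : Continuous fun b => ENNReal.ofReal (Real.exp (φ (b * l))) :=
      ENNReal.continuous_ofReal.comp (by fun_prop)
    exact (this.tendsto a).mono_left nhdsWithin_le_nhds
  refine ge_of_tendsto this ?_
  filter_upwards [self_mem_nhdsWithin] with b hb using h b hb l

theorem ExpBound.neg (hφ : IsOrliczN φ) (h : ExpBound φ μ ξ a) :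
    ExpBound φ μ (fun ω => -ξ ω) a := fun l => by
  have := h (-l)
  rw [mul_neg, hφ.even] at this
  simpa using this

/-- Hölder's inequality with exponents proportional to `a` and `b`: after rescaling, both factors
have the same bound, with argument `(a + b) * l`. -/
theorem ExpBound.add (hφ : IsOrliczN φ) (hξ : AEMeasurable ξ μ) (hη : AEMeasurable η μ)
    (ha : 0 ≤ a) (hb : 0 ≤ b) (h : ExpBound φ μ ξ a) (h' : ExpBound φ μ η b) :
    ExpBound φ μ (fun ω => ξ ω + η ω) (a + b) := by
  refine ExpBound.of_forall_gt hφ fun c hc l => ?_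
  -- Enlarging both constants keeps the Hölder weights positive even when `a` or `b` is `0`.
  obtain ⟨ε, hε, rfl⟩ : ∃ ε : ℝ, 0 < ε ∧ c = (a + ε) + (b + ε) :=
    ⟨(c - (a + b)) / 2, by linarith, by ring⟩
  replace h := h.mono hφ ha (by linarith : a ≤ a + ε)
  replace h' := h'.mono hφ hb (by linarith : b ≤ b + ε)
  have ha' : 0 < a + ε := by linarith
  have hb' : 0 < b + ε := by linarith
  generalize a + ε = a at *
  generalize b + ε = b at *
  have hs : 0 < a + b := by linarith
  have hp : 0 < a / (a + b) := by positivity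
  have hq : 0 < b / (a + b) := by positivity
  have hpq : a / (a + b) + b / (a + b) = 1 := by field_simp
  have e1 : ∀ ω, ENNReal.ofReal (Real.exp (l * (ξ ω + η ω)))
      = ENNReal.ofReal (Real.exp ((l * ((a + b) / a)) * ξ ω)) ^ (a / (a + b))
        * ENNReal.ofReal (Real.exp ((l * ((a + b) / b)) * η ω)) ^ (b / (a + b)) := fun ω => by
    rw [ENNReal.ofReal_rpow_of_pos (Real.exp_pos _), ENNReal.ofReal_rpow_of_pos (Real.exp_pos _),
      ← Real.exp_mul, ← Real.exp_mul, ← ENNReal.ofReal_mul (Real.exp_pos _).le, ← Real.exp_add]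
    congr 2
    field_simp
  simp_rw [e1]
  refine (ENNReal.lintegral_mul_norm_pow_le (by fun_prop) (by fun_prop) hp.le hq.le hpq).trans ?_
  have h1 := h (l * ((a + b) / a))
  have h2 := h' (l * ((a + b) / b))
  rw [show a * (l * ((a + b) / a)) = (a + b) * l by field_simp] at h1
  rw [show b * (l * ((a + b) / b)) = (a + b) * l by field_simp] at h2
  calc _ ≤ ENNReal.ofReal (Real.exp (φ ((a + b) * l))) ^ (a / (a + b))
        * ENNReal.ofReal (Real.exp (φ ((a + b) * l))) ^ (b / (a + b)) := by gcongr
    _ = _ := by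
      rw [← ENNReal.rpow_add _ _ (by simp [Real.exp_pos]) (by simp), hpq, ENNReal.rpow_one]

theorem ExpBound.sub (hφ : IsOrliczN φ) (hξ : AEMeasurable ξ μ) (hη : AEMeasurable η μ)
    (ha : 0 ≤ a) (hb : 0 ≤ b) (h : ExpBound φ μ ξ a) (h' : ExpBound φ μ η b) :
    ExpBound φ μ (fun ω => ξ ω - η ω) (a + b) := by
  simp only [sub_eq_add_neg]
  exact h.add hφ hξ hη.neg ha hb (h'.neg hφ)

theorem IsSub.sub (hφ : IsOrliczN φ) (h : IsSub φ μ ξ) (h' : IsSub φ μ η) :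
    IsSub φ μ (fun ω => ξ ω - η ω) := by
  obtain ⟨hm, a, ha, h⟩ := h
  obtain ⟨hm', b, hb, h'⟩ := h'
  exact ⟨hm.sub hm', a + b, by positivity, h.sub hφ hm hm' ha hb h'⟩

theorem tau_nonneg : 0 ≤ tau φ μ ξ := Real.sInf_nonneg fun _ h => h.1

theorem tau_le (ha : 0 ≤ a) (h : ExpBound φ μ ξ a) : tau φ μ ξ ≤ a :=
  csInf_le ⟨0, fun _ h => h.1⟩ ⟨ha, h⟩

theorem IsSub.expBound (hφ : IsOrliczN φ) (h : IsSub φ μ ξ) (ha : tau φ μ ξ ≤ a) :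
    ExpBound φ μ ξ a := by
  refine ExpBound.of_forall_gt hφ fun c hc => ?_
  obtain ⟨b, hb, hbc⟩ := exists_lt_of_csInf_lt h.2 (ha.trans_lt hc)
  exact hb.2.mono hφ hb.1 hbc.le

/-- Integrate `|ξ| ≤ b (exp (ξ / b) + exp (-ξ / b))` for `b > a` and let `b → a`; the limit covers
`a = 0`. -/
theorem ExpBound.lintegral_enorm_le (hφ : IsOrliczN φ) (hξ : AEMeasurable ξ μ) (ha : 0 ≤ a)
    (h : ExpBound φ μ ξ a) : ∫⁻ ω, ‖ξ ω‖ₑ ∂μ ≤ ENNReal.ofReal (a * (2 * Real.exp (φ 1))) := by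
  have : Tendsto (fun b => ENNReal.ofReal (b * (2 * Real.exp (φ 1)))) (𝓝[>] a)
      (𝓝 (ENNReal.ofReal (a * (2 * Real.exp (φ 1))))) := by
    have : Continuous fun b => ENNReal.ofReal (b * (2 * Real.exp (φ 1))) :=
      ENNReal.continuous_ofReal.comp (by fun_prop)
    exact (this.tendsto a).mono_left nhdsWithin_le_nhds
  refine ge_of_tendsto this ?_
  filter_upwards [self_mem_nhdsWithin] with b (hb : a < b)
  replace h := h.mono hφ ha hb.le
  have hb0 : 0 < b := ha.trans_lt hb
  have h1 := h b⁻¹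
  have h2 := h (-b⁻¹)
  rw [mul_neg, hφ.even] at h2
  rw [mul_inv_cancel₀ hb0.ne'] at h1 h2
  calc ∫⁻ ω, ‖ξ ω‖ₑ ∂μ
      ≤ ∫⁻ ω, ENNReal.ofReal b * (ENNReal.ofReal (Real.exp (b⁻¹ * ξ ω))
          + ENNReal.ofReal (Real.exp (-b⁻¹ * ξ ω))) ∂μ := by
        refine lintegral_mono fun ω => ?_
        rw [← ENNReal.ofReal_add (Real.exp_pos _).le (Real.exp_pos _).le,
          ← ENNReal.ofReal_mul hb0.le, Real.enorm_eq_ofReal_abs]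
        apply ENNReal.ofReal_le_ofReal
        have e1 := Real.add_one_le_exp (b⁻¹ * ξ ω)
        have e2 := Real.add_one_le_exp (-b⁻¹ * ξ ω)
        have p1 := Real.exp_pos (b⁻¹ * ξ ω)
        have p2 := Real.exp_pos (-b⁻¹ * ξ ω)
        have : |b⁻¹ * ξ ω| ≤ Real.exp (b⁻¹ * ξ ω) + Real.exp (-b⁻¹ * ξ ω) :=
          abs_le.2 ⟨by linarith, by linarith⟩
        calc |ξ ω| = b * |b⁻¹ * ξ ω| := by
              rw [abs_mul, abs_of_pos (inv_pos.2 hb0), mul_inv_cancel_left₀ hb0.ne']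
          _ ≤ _ := by gcongr
    _ = ENNReal.ofReal b * (∫⁻ ω, ENNReal.ofReal (Real.exp (b⁻¹ * ξ ω)) ∂μ
          + ∫⁻ ω, ENNReal.ofReal (Real.exp (-b⁻¹ * ξ ω)) ∂μ) := by
        rw [lintegral_const_mul'' _ (by fun_prop), lintegral_add_left' (by fun_prop)]
    _ ≤ ENNReal.ofReal b * (ENNReal.ofReal (Real.exp (φ 1)) + ENNReal.ofReal (Real.exp (φ 1))) := by
        gcongr
    _ = _ := by
        rw [← ENNReal.ofReal_add (Real.exp_pos _).le (Real.exp_pos _).le,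
          ← ENNReal.ofReal_mul hb0.le, two_mul]

end SubGaussian

/-! ### Chaining over finite sets. -/

section Chaining

variable {Ω B : Type*} [MeasurableSpace Ω] {μ : Measure Ω} {φ : ℝ → ℝ}

theorem lintegral_exp_add_exp_neg_le {ξ : Ω → ℝ} (hφ : IsOrliczN φ) (hξ : AEMeasurable ξ μ)
    {a w l : ℝ} (hw : 0 < w) (h : ExpBound φ μ ξ (a * w)) :
    ∫⁻ ω, (ENNReal.ofReal (Real.exp (l / w * ξ ω)) + ENNReal.ofReal (Real.exp (-(l / w) * ξ ω))) ∂μ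
      ≤ 2 * ENNReal.ofReal (Real.exp (φ (a * l))) := by
  have h1 := h (l / w)
  have h2 := h (-(l / w))
  rw [mul_neg, hφ.even] at h2
  rw [show a * w * (l / w) = a * l by field_simp] at h1 h2
  rw [lintegral_add_left' (by fun_prop), two_mul]
  gcongr

/-- Telescoping along `u, c u, ...` bounds `|Y u|` by a sum of links. The factor `f k` sums over all
of `V k`, hence dominates whichever link is used. Markov's and Hölder's inequalities finish. Link
constants are written `a k * w k` so that the Hölder rescaling `l / w k` leaves `φ (a k * l)`. -/
theorem chaining_tail (hφ : IsOrliczN φ) {Y : B → Ω → ℝ} (hY : ∀ t, AEMeasurable (Y t) μ) (n : ℕ)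
    (V : ℕ → Finset B) (c : ℕ → B → B) (hc : ∀ k < n, ∀ x ∈ V (k + 1), c k x ∈ V k)
    (w a : ℕ → ℝ) (hw : ∀ k, 0 < w k) (hsum : ∑ k ∈ Finset.range (n + 1), w k = 1)
    {l : ℝ} (hl : 0 ≤ l) (δ : ℝ) (h0 : ∀ u ∈ V 0, ExpBound φ μ (Y u) (a 0 * w 0))
    (hs : ∀ k < n, ∀ u ∈ V (k + 1),
      ExpBound φ μ (fun ω => Y u ω - Y (c k u) ω) (a (k + 1) * w (k + 1))) :
    ENNReal.ofReal (Real.exp (l * δ)) * μ {ω | ∃ s ∈ V n, δ < |Y s ω|}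
      ≤ ∏ k ∈ Finset.range (n + 1),
        ((V k).card * (2 * ENNReal.ofReal (Real.exp (φ (a k * l))))) ^ w k := by
  let Z : ℕ → B → Ω → ℝ := fun k u ω => k.casesOn (Y u ω) fun j => Y u ω - Y (c j u) ω
  have hZ : ∀ k u, AEMeasurable (Z k u) μ := fun k u => by
    cases k with
    | zero => exact hY u
    | succ j => exact (hY u).sub (hY _)
  have hZb : ∀ k < n + 1, ∀ u ∈ V k, ExpBound φ μ (Z k u) (a k * w k) := fun k hk u hu => by
    cases k with
    | zero => exact h0 u hu
    | succ j => exact hs j (by omega) u hu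
  let f : ℕ → Ω → ℝ≥0∞ := fun k ω => ∑ u ∈ V k,
    (ENNReal.ofReal (Real.exp (l / w k * Z k u ω))
      + ENNReal.ofReal (Real.exp (-(l / w k) * Z k u ω)))
  have hterm : ∀ k u, AEMeasurable (fun ω => ENNReal.ofReal (Real.exp (l / w k * Z k u ω))
      + ENNReal.ofReal (Real.exp (-(l / w k) * Z k u ω))) μ := fun k u => by
    have := hZ k u
    fun_prop
  have hf : ∀ k, AEMeasurable (f k) μ := fun k =>
    Finset.aemeasurable_fun_sum _ fun u _ => hterm k u
  have hfint : ∀ k < n + 1,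
      ∫⁻ ω, f k ω ∂μ ≤ (V k).card * (2 * ENNReal.ofReal (Real.exp (φ (a k * l)))) := fun k hk => by
    rw [lintegral_finsetSum' _ fun u _ => hterm k u]
    refine (Finset.sum_le_card_nsmul _ _ _ fun u hu =>
      lintegral_exp_add_exp_neg_le hφ (hZ k u) (hw k) (hZb k hk u hu)).trans_eq ?_
    rw [nsmul_eq_mul]
  have hstep : ∀ k, ∀ u ∈ V k, ∀ ω, ENNReal.ofReal (Real.exp (l * |Z k u ω|)) ≤ f k ω ^ w k := by
    intro k u hu ω
    have : ENNReal.ofReal (Real.exp (l / w k * |Z k u ω|)) ≤ f k ω := by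
      refine le_trans ?_ (Finset.single_le_sum (fun _ _ => zero_le) hu)
      rcases abs_choice (Z k u ω) with h | h <;> rw [h]
      · exact le_self_add
      · rw [mul_neg, ← neg_mul]
        exact le_add_self
    calc ENNReal.ofReal (Real.exp (l * |Z k u ω|))
        = ENNReal.ofReal (Real.exp (l / w k * |Z k u ω|)) ^ w k := by
          rw [ENNReal.ofReal_rpow_of_pos (Real.exp_pos _), ← Real.exp_mul]
          congr 2
          have := hw k
          field_simp
      _ ≤ _ := ENNReal.rpow_le_rpow this (hw k).le
  have hchain : ∀ k, k ≤ n → ∀ u ∈ V k, ∀ ω, ENNReal.ofReal (Real.exp (l * |Y u ω|))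
      ≤ ∏ j ∈ Finset.range (k + 1), f j ω ^ w j := by
    intro k
    induction k with
    | zero => exact fun _ u hu ω => (hstep 0 u hu ω).trans_eq (by simp)
    | succ k ih =>
      intro hk u hu ω
      rw [Finset.prod_range_succ]
      refine le_trans ?_ (mul_le_mul' (ih (by omega) (c k u) (hc k (by omega) u hu) ω)
        (hstep (k + 1) u hu ω))
      rw [← ENNReal.ofReal_mul (Real.exp_pos _).le, ← Real.exp_add, ← mul_add]
      gcongr
      have := abs_add_le (Y (c k u) ω) (Y u ω - Y (c k u) ω)
      rwa [add_sub_cancel] at this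
  have hmeas : AEMeasurable (fun ω => ∏ j ∈ Finset.range (n + 1), f j ω ^ w j) μ :=
    Finset.aemeasurable_fun_prod _ fun k _ => (hf k).pow_const _
  calc _ ≤ ENNReal.ofReal (Real.exp (l * δ)) *
        μ {ω | ENNReal.ofReal (Real.exp (l * δ)) ≤ ∏ j ∈ Finset.range (n + 1), f j ω ^ w j} := by
        refine mul_le_mul_right (measure_mono ?_) _
        rintro ω ⟨s, hs, hδ⟩
        change ENNReal.ofReal (Real.exp (l * δ)) ≤ ∏ j ∈ Finset.range (n + 1), f j ω ^ w j
        refine le_trans ?_ (hchain n le_rfl s hs ω)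
        gcongr
    _ ≤ ∫⁻ ω, ∏ j ∈ Finset.range (n + 1), f j ω ^ w j ∂μ := mul_meas_ge_le_lintegral₀ hmeas _
    _ ≤ ∏ j ∈ Finset.range (n + 1), (∫⁻ ω, f j ω ∂μ) ^ w j :=
        ENNReal.lintegral_prod_norm_pow_le _ (fun k _ => hf k) hsum fun k _ => (hw k).le
    _ ≤ _ := Finset.prod_le_prod' fun k hk =>
        ENNReal.rpow_le_rpow (hfint k (Finset.mem_range.1 hk)) (hw k).le

end Chaining

/-! ### Entropy weights: Jensen's inequality and the inverse. -/

section Weight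

variable {r : ℝ → ℝ}

theorem IsEntropyWeight.map_exp_sum_le (hr : IsEntropyWeight r) {ι : Type*} (s : Finset ι)
    {w x : ι → ℝ} (hw : ∀ i ∈ s, 0 ≤ w i) (hsum : ∑ i ∈ s, w i = 1) (hx : ∀ i ∈ s, 0 ≤ x i) :
    r (Real.exp (∑ i ∈ s, w i * x i)) ≤ ∑ i ∈ s, w i * r (Real.exp (x i)) := by
  have key : ∀ ε : ℝ, 0 < ε → r (Real.exp (∑ i ∈ s, w i * x i + ε))
      ≤ ∑ i ∈ s, w i * r (Real.exp (x i + ε)) := fun ε hε => by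
    -- Convexity holds only on the open half-line, while logarithms of net sizes may vanish; hence
    -- the shift by `ε`.
    have := hr.convexOn.map_sum_le hw hsum (p := fun i => x i + ε)
      fun i hi => by have := hx i hi; simp only [mem_Ioi]; linarith
    simpa only [smul_eq_mul, mul_add, Finset.sum_add_distrib, ← Finset.sum_mul, hsum, one_mul]
      using this
  have hlim : ∀ y : ℝ, 0 ≤ y →
      Tendsto (fun ε => r (Real.exp (y + ε))) (𝓝[>] 0) (𝓝 (r (Real.exp y))) := fun y hy => by
    refine (hr.continuousOn _ (Real.one_le_exp hy)).tendsto.comp ?_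
    refine tendsto_nhdsWithin_iff.2 ⟨?_, ?_⟩
    · have : Continuous fun ε => Real.exp (y + ε) := by fun_prop
      simpa using (this.tendsto 0).mono_left nhdsWithin_le_nhds
    · filter_upwards [self_mem_nhdsWithin] with ε (hε : 0 < ε)
      exact Real.one_le_exp (by linarith)
  refine le_of_tendsto_of_tendsto
    (hlim _ (Finset.sum_nonneg fun i hi => mul_nonneg (hw i hi) (hx i hi)))
    (tendsto_finsetSum _ fun i hi => (hlim _ (hx i hi)).const_mul _) ?_
  filter_upwards [self_mem_nhdsWithin] with ε hε using key ε hε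

/-- A strictly increasing convex function is unbounded: `q` is the length at which the secant
through `1` and `2` exceeds `M`. -/
theorem IsEntropyWeight.exists_le (hr : IsEntropyWeight r) (M : ℝ) : ∃ y, 1 ≤ y ∧ M ≤ r y := by
  set g : ℝ → ℝ := fun t => r (Real.exp t) with hg
  have h12 : g 1 < g 2 := hr.strictMonoOn (Real.one_le_exp (by norm_num))
    (Real.one_le_exp (by norm_num)) (Real.exp_lt_exp.2 (by norm_num))
  have hd : 0 < g 2 - g 1 := sub_pos.2 h12
  set q : ℝ := 1 + |M - g 1| / (g 2 - g 1) with hq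
  have hq1 : 1 ≤ q := by
    rw [hq]
    have : 0 ≤ |M - g 1| / (g 2 - g 1) := by positivity
    linarith
  have hq0 : 0 < q := by linarith
  refine ⟨Real.exp (1 + q), Real.one_le_exp (by linarith), ?_⟩
  have := hr.convexOn.2 (x := 1) (by simp) (y := 1 + q) (by simp only [mem_Ioi]; linarith)
    (sub_nonneg.2 (inv_le_one_of_one_le₀ hq1)) (inv_nonneg.2 hq0.le) (by ring)
  have e : (1 - q⁻¹) • (1 : ℝ) + q⁻¹ • (1 + q) = 2 := by
    simp only [smul_eq_mul]; field_simp; ring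
  rw [e] at this
  change g 2 ≤ (1 - q⁻¹) * g 1 + q⁻¹ * g (1 + q) at this
  have h2 : q * (g 2 - g 1) ≤ g (1 + q) - g 1 := by
    have := mul_le_mul_of_nonneg_left this hq0.le
    field_simp at this
    linarith
  have h3 : q * (g 2 - g 1) = (g 2 - g 1) + |M - g 1| := by
    rw [hq]; field_simp
  have := le_abs_self (M - g 1)
  change M ≤ g (1 + q)
  linarith

/-- Unboundedness and the intermediate value theorem put `I` in the range of `r`, so `invFunOn`
returns a true preimage. -/
theorem IsEntropyWeight.le_weightInv (hr : IsEntropyWeight r) {y I : ℝ} (hy : 1 ≤ y)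
    (h : r y ≤ I) : y ≤ weightInv r I := by
  obtain ⟨z, hz, hzI⟩ := hr.exists_le I
  have hyz : y ≤ z := (hr.strictMonoOn.le_iff_le hy hz).1 (h.trans hzI)
  obtain ⟨x, hx, hxI⟩ := intermediate_value_Icc hyz
    (hr.continuousOn.mono fun t ht => hy.trans ht.1) ⟨h, hzI⟩
  have hex : ∃ x ∈ Ici (1 : ℝ), r x = I := ⟨x, hy.trans hx.1, hxI⟩
  refine (hr.strictMonoOn.le_iff_le hy (Function.invFunOn_mem hex)).1 ?_
  rwa [Function.invFunOn_eq hex]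

end Weight

/-! ### Moduli and covering numbers. -/

section Massiveness

variable {B : Type*} [PseudoMetricSpace B] {σ r : ℝ → ℝ}

theorem modInv_mono {u v : ℝ} (h : u ≤ v) : modInv σ u ≤ modInv σ v :=
  iSup_mono fun _ => iSup_mono' fun hx => ⟨hx.trans h, le_rfl⟩

theorem IsModulus.modInv_pos (hσ : IsModulus σ) {u : ℝ} (hu : 0 < u) : 0 < modInv σ u := by
  have h0 := hσ.continuousOn 0 self_mem_Ici
  have : ∀ᶠ h in 𝓝[≥] (0 : ℝ), σ h < u := h0.tendsto.eventually_lt_const (by rwa [hσ.map_zero])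
  have h2 : ∀ᶠ h in 𝓝[>] (0 : ℝ), σ h < u := this.filter_mono (nhdsWithin_mono _ Ioi_subset_Ici_self)
  obtain ⟨h, hh, hpos⟩ := (h2.and self_mem_nhdsWithin).exists
  have hpos' : (0 : ℝ) < h := hpos
  lift h to ℝ≥0 using hpos'.le
  exact (ENNReal.coe_pos.2 (by exact_mod_cast hpos')).trans_le (le_iSup₂_of_le h hh.le le_rfl)

/-- The supremum defining `modInv` need not be attained when it is infinite. Every distance strictly
below `dist x y` satisfies the bound, and left continuity of `σ` gives the endpoint. -/
theorem IsModulus.le_of_edist_le_modInv (hσ : IsModulus σ) {u : ℝ} (hu : 0 ≤ u) {x y : B}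
    (h : edist x y ≤ modInv σ u) : σ (dist x y) ≤ u := by
  have hlt : ∀ d : ℝ, 0 ≤ d → d < dist x y → σ d ≤ u := fun d hd hlt => by
    have : ENNReal.ofReal d < modInv σ u := by
      refine lt_of_lt_of_le ?_ h
      rw [edist_dist]
      exact (ENNReal.ofReal_lt_ofReal_iff (hd.trans_lt hlt)).2 hlt
    simp only [modInv, lt_iSup_iff] at this
    obtain ⟨e, he, hde⟩ := this
    rw [← ENNReal.ofReal_coe_nnreal, ENNReal.ofReal_lt_ofReal_iff_of_nonneg hd] at hde
    exact (hσ.monotoneOn hd (mem_Ici.2 e.2) hde.le).trans he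
  rcases (dist_nonneg (x := x) (y := y)).eq_or_lt with h0 | h0
  · rw [← h0, hσ.map_zero]; exact hu
  have hc : Tendsto σ (𝓝[Ico 0 (dist x y)] (dist x y)) (𝓝 (σ (dist x y))) :=
    (hσ.continuousOn _ (mem_Ici.2 h0.le)).tendsto.mono_left
      (nhdsWithin_mono _ Ico_subset_Ici_self)
  have : (𝓝[Ico 0 (dist x y)] (dist x y)).NeBot := by
    rw [nhdsWithin_Ico_eq_nhdsLT h0]; infer_instance
  refine le_of_tendsto hc ?_
  filter_upwards [self_mem_nhdsWithin] with d hd using hlt d hd.1 hd.2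

theorem exists_net [CompactSpace B] {u : ℝ≥0∞} (hu : 0 < u) :
    ∃ C : Finset B, C.card = massiveness B u ∧ ∀ x : B, ∃ c ∈ C, edist x c ≤ u := by
  refine Nat.sInf_mem (s := {n : ℕ | ∃ C : Finset B, C.card = n ∧ ∀ x : B, ∃ c ∈ C, edist x c ≤ u}) ?_
  obtain ⟨t, -, htf, ht⟩ := EMetric.totallyBounded_iff'.1 (isCompact_univ (X := B)).totallyBounded u hu
  refine ⟨_, htf.toFinset, rfl, fun x => ?_⟩
  have := ht (mem_univ x)
  simp only [mem_iUnion] at this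
  obtain ⟨c, hc, hx⟩ := this
  exact ⟨c, htf.mem_toFinset.2 hc, (Metric.mem_eball.1 hx).le⟩

theorem massiveness_anti [CompactSpace B] {u v : ℝ≥0∞} (hu : 0 < u) (h : u ≤ v) :
    massiveness B v ≤ massiveness B u := by
  obtain ⟨C, hC, hcov⟩ := exists_net (B := B) hu
  rw [← hC]
  exact Nat.sInf_le ⟨C, rfl, fun x => (hcov x).imp fun c hc => ⟨hc.1, hc.2.trans h⟩⟩

theorem one_le_massiveness [CompactSpace B] [Nonempty B] {u : ℝ≥0∞} (hu : 0 < u) :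
    1 ≤ massiveness B u := by
  obtain ⟨C, hC, hcov⟩ := exists_net (B := B) hu
  obtain ⟨x⟩ := ‹Nonempty B›
  rw [← hC, Nat.one_le_iff_ne_zero, ← Nat.pos_iff_ne_zero, Finset.card_pos]
  obtain ⟨c, hc, -⟩ := hcov x
  exact ⟨c, hc⟩

theorem antitoneOn_entropyFun [CompactSpace B] [Nonempty B] (hr : IsEntropyWeight r)
    (hσ : IsModulus σ) : AntitoneOn (entropyFun B r σ) (Ioi 0) := fun u hu v hv h =>
  hr.strictMonoOn.monotoneOn
    (mem_Ici.2 (by exact_mod_cast one_le_massiveness (hσ.modInv_pos hv)))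
    (mem_Ici.2 (by exact_mod_cast one_le_massiveness (hσ.modInv_pos hu)))
    (by exact_mod_cast massiveness_anti (hσ.modInv_pos hu) (modInv_mono h))

theorem one_le_entropyFun [CompactSpace B] [Nonempty B] (hr : IsEntropyWeight r)
    (hσ : IsModulus σ) {u : ℝ} (hu : 0 < u) : r 1 ≤ entropyFun B r σ u :=
  hr.strictMonoOn.monotoneOn (mem_Ici.2 le_rfl)
    (mem_Ici.2 (by exact_mod_cast one_le_massiveness (hσ.modInv_pos hu)))
    (by exact_mod_cast one_le_massiveness (hσ.modInv_pos hu))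

end Massiveness

/-- On `(b p ^ (k + 1), b p ^ k)`, of length `b (1 - p) p ^ k`, the function is at least its value
at the right end; on the remaining `(0, b p ^ n)` it is at least `m₀`. Induction rescales `b` to `b
p`. -/
theorem geometric_sum_le_setIntegral {f : ℝ → ℝ} {m₀ p : ℝ} (hp0 : 0 < p) (hp1 : p < 1)
    (hf : AntitoneOn f (Ioi 0)) (hm : ∀ u, 0 < u → m₀ ≤ f u) (n : ℕ) {b : ℝ} (hb : 0 < b)
    (hint : IntegrableOn f (Ioo 0 b)) :
    b * (∑ k ∈ Finset.range n, (1 - p) * p ^ k * f (b * p ^ k) + p ^ n * m₀)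
      ≤ ∫ u in Ioo 0 b, f u := by
  have hconst : ∀ (s t c : ℝ), s ≤ t → IntegrableOn f (Ioo s t) → (∀ u ∈ Ioo s t, c ≤ f u) →
      (t - s) * c ≤ ∫ u in Ioo s t, f u := fun s t c hst hi hc => by
    have := setIntegral_mono_on (integrableOn_const (by simp)) hi measurableSet_Ioo hc
    simpa [hst, mul_comm] using this
  induction n generalizing b with
  | zero =>
    have := hconst 0 b m₀ hb.le hint fun u hu => hm u hu.1
    simpa using this
  | succ n ih =>
    have hbp : 0 < b * p := mul_pos hb hp0
    have hbpb : b * p < b := mul_lt_of_lt_one_right hb hp1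
    have i1 : IntegrableOn f (Ioo 0 (b * p)) := hint.mono_set (Ioo_subset_Ioo_right hbpb.le)
    have i2 : IntegrableOn f (Ioo (b * p) b) := hint.mono_set (Ioo_subset_Ioo_left hbp.le)
    have h1 := ih hbp i1
    have h2 := hconst (b * p) b (f b) hbpb.le i2 fun u hu => hf (hbp.trans hu.1) hb hu.2.le
    have hsplit : ∫ u in Ioo 0 b, f u = (∫ u in Ioo 0 (b * p), f u) + ∫ u in Ioo (b * p) b, f u := by
      rw [← integral_Ioc_eq_integral_Ioo, ← integral_Ioc_eq_integral_Ioo,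
        ← integral_Ioc_eq_integral_Ioo, ← Ioc_union_Ioc_eq_Ioc hbp.le hbpb.le]
      exact setIntegral_union (Ioc_disjoint_Ioc_of_le le_rfl) measurableSet_Ioc
        ((integrableOn_Ioc_iff_integrableOn_Ioo (by simp)).2 i1) ((integrableOn_Ioc_iff_integrableOn_Ioo (by simp)).2 i2)
    rw [hsplit, Finset.sum_range_succ']
    refine le_trans (le_of_eq ?_) (add_le_add h1 h2)
    have : ∑ k ∈ Finset.range n, (1 - p) * p ^ (k + 1) * f (b * p ^ (k + 1))
        = p * ∑ k ∈ Finset.range n, (1 - p) * p ^ k * f (b * p * p ^ k) := by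
      rw [Finset.mul_sum]
      refine Finset.sum_congr rfl fun k _ => ?_
      rw [pow_succ', ← mul_assoc b]
      ring
    rw [this]
    ring_nf

theorem sum_range_succ_eq {f g : ℕ → ℝ} {n : ℕ} (h : ∀ k < n, f k = g k) :
    ∑ k ∈ Finset.range (n + 1), f k = ∑ k ∈ Finset.range n, g k + f n := by
  rw [Finset.sum_range_succ, Finset.sum_congr rfl fun k hk => h k (Finset.mem_range.1 hk)]

/-! ### Tail bound over a finite set. -/

section FiniteTail

variable {Ω B : Type*} [MeasurableSpace Ω] {μ : Measure Ω} {φ : ℝ → ℝ}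
  [PseudoMetricSpace B] [CompactSpace B] [Nonempty B]

theorem exp_sum_log_massiveness_le {r σ : ℝ → ℝ} (hr : IsEntropyWeight r) (hσ : IsModulus σ)
    {b p : ℝ} (hp0 : 0 < p) (hp1 : p < 1) (hb : 0 < b)
    (hint : IntegrableOn (entropyFun B r σ) (Ioo 0 b)) (n : ℕ) :
    Real.exp (∑ k ∈ Finset.range n, (1 - p) * p ^ k * Real.log (massiveness B (modInv σ (b * p ^ k))))
      ≤ weightInv r (1 / b * ∫ u in Ioo 0 b, entropyFun B r σ u) := by
  set M : ℕ → ℝ := fun k => massiveness B (modInv σ (b * p ^ k)) with hM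
  have hM1 : ∀ k, 1 ≤ M k := fun k => by
    have := one_le_massiveness (B := B) (hσ.modInv_pos (mul_pos hb (pow_pos hp0 k)))
    simp only [hM]
    exact_mod_cast this
  have hlog : ∀ k, 0 ≤ Real.log (M k) := fun k => Real.log_nonneg (hM1 k)
  have hp1' : 0 < 1 - p := by linarith
  refine hr.le_weightInv (Real.one_le_exp (Finset.sum_nonneg fun k _ =>
    mul_nonneg (by positivity) (hlog k))) ?_
  have hgeom : ∑ k ∈ Finset.range n, (1 - p) * p ^ k + p ^ n = 1 := by
    rw [← Finset.mul_sum, mul_neg_geom_sum]; ring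
  -- The missing mass `p ^ n` is placed at `log 1 = 0`; its value `r 1` is the remainder term of the
  -- geometric comparison.
  set w : ℕ → ℝ := fun k => if k < n then (1 - p) * p ^ k else p ^ n with hw
  set x : ℕ → ℝ := fun k => if k < n then Real.log (M k) else 0 with hx
  have hJ := hr.map_exp_sum_le (Finset.range (n + 1)) (w := w) (x := x)
    (fun k _ => by simp only [hw]; split_ifs <;> positivity)
    (by
      rw [sum_range_succ_eq (g := fun k => (1 - p) * p ^ k) fun k hk => if_pos hk]
      simpa [hw] using hgeom)
    (fun k _ => by simp only [hx]; split_ifs; exacts [hlog k, le_rfl])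
  rw [sum_range_succ_eq (g := fun k => (1 - p) * p ^ k * Real.log (M k))
      fun k hk => by simp only [hw, hx, if_pos hk],
    sum_range_succ_eq (g := fun k => (1 - p) * p ^ k * r (M k)) fun k hk => by
      simp only [hw, hx, if_pos hk, Real.exp_log (zero_lt_one.trans_le (hM1 k))]] at hJ
  simp only [hw, hx, lt_irrefl, if_false, mul_zero, add_zero, Real.exp_zero] at hJ
  refine hJ.trans ?_
  have := geometric_sum_le_setIntegral hp0 hp1 (antitoneOn_entropyFun hr hσ)
    (fun u hu => one_le_entropyFun hr hσ hu) n hb hint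
  rw [one_div, inv_mul_eq_div, le_div_iff₀' hb]
  exact this

theorem finite_tail (hφ : IsOrliczN φ) {Y : B → Ω → ℝ} (hY : ∀ t, AEMeasurable (Y t) μ)
    {r σ : ℝ → ℝ} (hr : IsEntropyWeight r) (hσ : IsModulus σ) {γ β p x : ℝ}
    (hp0 : 0 < p) (hp1 : p < 1) (hβ : 0 < β) (hx : 0 ≤ x)
    (hint : IntegrableOn (entropyFun B r σ) (Ioo 0 (β * p)))
    (hγ : ∀ u, ExpBound φ μ (Y u) γ)
    (hinc : ∀ t s, ∀ c, 0 ≤ c → σ (dist t s) ≤ c → ExpBound φ μ (fun ω => Y t ω - Y s ω) c)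
    (δ : ℝ) (F : Finset B) (hF : F.Nonempty) {m : ℕ} (hm : 0 < m) :
    ENNReal.ofReal (Real.exp (x * (1 - p) * δ)) * μ {ω | ∃ s ∈ F, δ < |Y s ω|}
      ≤ ENNReal.ofReal (Real.exp (p ^ m * Real.log F.card) *
        (2 * (Real.exp ((1 - p) * φ (γ * x) + p * φ (β * x)) *
          weightInv r (1 / (β * p) * ∫ u in Ioo 0 (β * p), entropyFun B r σ u)))) := by
  have hp1' : 0 < 1 - p := by linarith
  have hb : 0 < β * p := by positivity
  have hbk : ∀ k : ℕ, 0 < β * p * p ^ k := fun k => by positivity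
  choose C hCcard hCcov using fun k : ℕ => exists_net (B := B) (hσ.modInv_pos (hbk k))
  choose c hcC hcd using hCcov
  set V : ℕ → Finset B := fun k => if k < m then C k else F with hV
  set w : ℕ → ℝ := fun k => if k < m then (1 - p) * p ^ k else p ^ m with hw
  -- With this choice `a (k + 1) * w (k + 1)` is the increment level `β p ^ (k + 1)` of net `k`, and
  -- `a k * (x * (1 - p))` is `γ x` or `β x`.
  set a : ℕ → ℝ := fun k => (if k = 0 then γ else β) / (1 - p) with ha
  have hwpos : ∀ k, 0 < w k := fun k => by simp only [hw]; split_ifs <;> positivity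
  have hsum : ∑ k ∈ Finset.range (m + 1), w k = 1 := by
    rw [sum_range_succ_eq (g := fun k => (1 - p) * p ^ k) fun k hk => if_pos hk, ← Finset.mul_sum,
      mul_neg_geom_sum]
    simp
  have hw0 : w 0 = 1 - p := by simp [hw, hm]
  have hVm : V m = F := by simp [hV]
  have hwle : ∀ k, k + 1 ≤ m → β * p * p ^ k ≤ a (k + 1) * w (k + 1) := fun k hk => by
    simp only [ha, hw, Nat.succ_ne_zero, if_false]
    split_ifs with h
    · apply le_of_eq; field_simp; ring
    -- The last weight `p ^ m` lacks the factor `1 - p`, so here only an inequality holds.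
    · obtain rfl : m = k + 1 := by omega
      rw [div_mul_eq_mul_div, le_div_iff₀ hp1', mul_assoc β, ← pow_succ']
      exact mul_le_of_le_one_right (by positivity) (by linarith)
  have hchain := chaining_tail hφ hY m V c
    (fun k hk u _ => by simpa only [hV, if_pos hk] using hcC k u) w a hwpos hsum
    (l := x * (1 - p)) (by positivity) δ
    (fun u _ => by
      have : a 0 * w 0 = γ := by rw [hw0]; simp [ha, hp1'.ne']
      rw [this]; exact hγ u)
    (fun k hk u _ => hinc _ _ _ ((hbk k).le.trans (hwle k hk))
      ((hσ.le_of_edist_le_modInv (hbk k).le (hcd k u)).trans (hwle k hk)))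
  rw [hVm] at hchain
  refine hchain.trans ?_
  have hcard : ∀ k, 0 < (V k).card := fun k => by
    simp only [hV]
    split_ifs
    · rw [hCcard]; exact one_le_massiveness (hσ.modInv_pos (hbk k))
    · exact hF.card_pos
  have hfac : ∀ k, ((V k).card * (2 * ENNReal.ofReal (Real.exp (φ (a k * (x * (1 - p)))))))
      ^ w k = ENNReal.ofReal (Real.exp (w k * Real.log (V k).card
        + (w k * Real.log 2 + w k * φ (a k * (x * (1 - p)))))) := fun k => by
    have h1 : (0 : ℝ) < (V k).card := by exact_mod_cast hcard k
    rw [← mul_add, ← mul_add, mul_comm (w k), Real.exp_mul, Real.exp_add, Real.exp_add,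
      Real.exp_log h1, Real.exp_log two_pos, ← ENNReal.ofReal_rpow_of_pos (by positivity),
      ENNReal.ofReal_mul h1.le, ENNReal.ofReal_mul two_pos.le, ENNReal.ofReal_natCast,
      ENNReal.ofReal_ofNat]
  rw [Finset.prod_congr rfl fun k _ => hfac k,
    ← ENNReal.ofReal_prod_of_nonneg fun _ _ => (Real.exp_pos _).le, ← Real.exp_sum,
    Finset.sum_add_distrib, Finset.sum_add_distrib, ← Finset.sum_mul, hsum, one_mul]
  apply ENNReal.ofReal_le_ofReal
  have e1 : ∑ k ∈ Finset.range (m + 1), w k * Real.log (V k).card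
      = ∑ k ∈ Finset.range m, (1 - p) * p ^ k *
          Real.log (massiveness B (modInv σ (β * p * p ^ k))) + p ^ m * Real.log F.card := by
    rw [sum_range_succ_eq (g := fun k => (1 - p) * p ^ k *
      Real.log (massiveness B (modInv σ (β * p * p ^ k))))
      fun k hk => by simp only [hw, hV, if_pos hk, hCcard]]
    simp [hw, hV]
  have e2 : ∑ k ∈ Finset.range (m + 1), w k * φ (a k * (x * (1 - p)))
      = (1 - p) * φ (γ * x) + p * φ (β * x) := by
    rw [Finset.sum_range_succ'] at hsum ⊢
    rw [hw0] at hsum ⊢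
    have h0 : a 0 * (x * (1 - p)) = γ * x := by simp only [ha, if_true]; field_simp
    have hk : ∀ k, a (k + 1) * (x * (1 - p)) = β * x := fun k => by
      simp only [ha, Nat.succ_ne_zero, if_false]; field_simp
    simp only [h0, hk]
    rw [← Finset.sum_mul]
    linear_combination φ (β * x) * hsum
  rw [e1, e2, Real.exp_add, Real.exp_add, Real.exp_add, Real.exp_log two_pos]
  calc _ = Real.exp (p ^ m * Real.log F.card) * (2 * (Real.exp ((1 - p) * φ (γ * x) + p * φ (β * x)) *
        Real.exp (∑ k ∈ Finset.range m, (1 - p) * p ^ k *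
          Real.log (massiveness B (modInv σ (β * p * p ^ k)))))) := by ring
    _ ≤ _ := by
      gcongr
      exact exp_sum_log_massiveness_le hr hσ hp0 hp1 hb hint m

end FiniteTail

/-! ### Path continuity of the model. -/

/-- A process that is a finite sum of random variables times deterministic functions and is
continuous in `L¹` has almost surely continuous paths. -/
theorem ae_continuous_of_finite_sum {Ω B : Type*} [MeasurableSpace Ω] {μ : Measure Ω}
    [TopologicalSpace B] {n : ℕ} {Y : B → Ω → ℝ} (ξ : Fin n → Ω → ℝ) (a : B → Fin n → ℝ)
    (hY : ∀ t ω, Y t ω = a t ⬝ᵥ fun i => ξ i ω) (hint : ∀ t, Integrable (Y t) μ)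
    (hcont : ∀ t, Tendsto (fun s => ∫⁻ ω, ‖Y s ω - Y t ω‖ₑ ∂μ) (𝓝 t) (𝓝 0)) :
    ∀ᵐ ω ∂μ, Continuous fun t => Y t ω := by
  -- The individual `ξ i` need not be integrable, so only coefficient vectors with an integrable
  -- combination are used.
  let V : Submodule ℝ (Fin n → ℝ) :=
    { carrier := {c | Integrable (fun ω => c ⬝ᵥ fun i => ξ i ω) μ}
      add_mem' := fun {c d} hc hd => by
        simp only [mem_ofPred_eq, add_dotProduct] at *
        exact hc.add hd
      zero_mem' := by simp
      smul_mem' := fun x c hc => by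
        simp only [mem_ofPred_eq, smul_dotProduct] at *
        exact hc.smul x }
  have hV : ∀ c : V, Integrable (fun ω => c.1 ⬝ᵥ fun i => ξ i ω) μ := fun c => c.2
  let T : V →ₗ[ℝ] (Ω →₁[μ] ℝ) :=
    { toFun := fun c => (hV c).toL1 _
      map_add' := fun c d => by
        rw [← Integrable.toL1_add]
        refine (Integrable.toL1_eq_toL1_iff _ _ _ _).2 (Eventually.of_forall fun ω => ?_)
        simp [add_dotProduct]
      map_smul' := fun x c => by
        rw [RingHom.id_apply, ← Integrable.toL1_smul]
        refine (Integrable.toL1_eq_toL1_iff _ _ _ _).2 (Eventually.of_forall fun ω => ?_)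
        simp [smul_dotProduct] }
  obtain ⟨g, hg⟩ := T.rangeRestrict.exists_rightInverse_of_surjective T.range_rangeRestrict
  have hgc : Continuous g := g.continuous_of_finiteDimensional
  -- The kernel is finitely generated, so one null set serves all its vectors.
  have hker : ∀ᵐ ω ∂μ, ∀ c ∈ LinearMap.ker T, c.1 ⬝ᵥ (fun i => ξ i ω) = 0 := by
    obtain ⟨S, hS⟩ := IsNoetherian.noetherian (LinearMap.ker T)
    have hS0 : ∀ᵐ ω ∂μ, ∀ c ∈ S, c.1 ⬝ᵥ (fun i => ξ i ω) = 0 := by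
      refine (Finset.eventually_all S).2 fun c hc => ?_
      have : T c = 0 := by
        rw [← LinearMap.mem_ker, ← hS]
        exact Submodule.subset_span hc
      have h0 : (hV c).toL1 _ = 0 := this
      have h1 := (hV c).coeFn_toL1
      rw [h0] at h1
      filter_upwards [h1, Lp.coeFn_zero ℝ 1 μ] with ω h1 h2
      rw [← h1, h2, Pi.zero_apply]
    filter_upwards [hS0] with ω hω c hc
    rw [← hS] at hc
    induction hc using Submodule.span_induction with
    | mem c hc => exact hω c hc
    | zero => simp
    | add c d _ _ hc hd => simp [add_dotProduct, hc, hd]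
    | smul x c _ hc => simp [smul_dotProduct, hc]
  let A : B → V := fun t => ⟨a t, by
    change Integrable _ μ
    simpa only [← hY] using hint t⟩
  have hTA : Continuous fun t => T (A t) := by
    refine continuous_iff_continuousAt.2 fun t => ?_
    rw [ContinuousAt, tendsto_iff_edist_tendsto_0]
    refine (hcont t).congr fun s => ?_
    change _ = edist ((hV (A s)).toL1 _) ((hV (A t)).toL1 _)
    rw [Integrable.edist_toL1_toL1]
    simp only [edist_eq_enorm_sub, hY]
    rfl
  -- `a` itself may be discontinuous. A linear section of `T`, continuous in finite dimension, gives
  -- continuous coefficients differing from `a` by kernel vectors.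
  let W : B → V := fun t => g (T.rangeRestrict (A t))
  have hW : Continuous W := hgc.comp (hTA.subtype_mk _)
  have hAW : ∀ t, A t - W t ∈ LinearMap.ker T := fun t => by
    have : T.rangeRestrict (W t) = T.rangeRestrict (A t) :=
      LinearMap.congr_fun hg (T.rangeRestrict (A t))
    rw [LinearMap.mem_ker, map_sub, sub_eq_zero]
    exact (congrArg Subtype.val this).symm
  filter_upwards [hker] with ω hω
  have : (fun t => Y t ω) = fun t => (W t).1 ⬝ᵥ fun i => ξ i ω := funext fun t => by
    have := hω _ (hAW t)
    rw [Submodule.coe_sub, sub_dotProduct, sub_eq_zero] at this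
    rw [hY]
    exact this
  rw [this]
  have hc := continuous_subtype_val.comp hW
  exact hc.dotProduct continuous_const

/-! ### From finite to countable sets. -/

theorem measure_exists_mem_le_of_finset {Ω B : Type*} [MeasurableSpace Ω] {μ : Measure Ω}
    {S : Set B} (hS : S.Countable) {Q : B → Ω → Prop} {K : ℝ≥0∞}
    (h : ∀ F : Finset B, μ {ω | ∃ s ∈ F, Q s ω} ≤ K) : μ {ω | ∃ s ∈ S, Q s ω} ≤ K := by
  classical
  have := hS.to_subtype
  have hU : {ω | ∃ s ∈ S, Q s ω} =
      ⋃ F : Finset S, {ω | ∃ s ∈ F.image ((↑) : S → B), Q s ω} := by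
    ext ω
    simp only [mem_ofPred_eq, mem_iUnion]
    constructor
    · rintro ⟨s, hs, hQ⟩
      exact ⟨{⟨s, hs⟩}, s, by simp, hQ⟩
    · rintro ⟨F, s, hs, hQ⟩
      obtain ⟨s', -, rfl⟩ := Finset.mem_image.1 hs
      exact ⟨s', s'.2, hQ⟩
  rw [hU, Directed.measure_iUnion]
  · exact iSup_le fun F => h _
  · refine Monotone.directed_le fun F G hFG ω => ?_
    rintro ⟨s, hs, hQ⟩
    exact ⟨s, Finset.image_subset_image hFG hs, hQ⟩

theorem entropy_tail {Ω B : Type*} [MeasurableSpace Ω] {μ : Measure Ω} {φ : ℝ → ℝ}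
    [PseudoMetricSpace B] [CompactSpace B] [Nonempty B]
    (hφ : IsOrliczN φ) {Y : B → Ω → ℝ} (hY : ∀ t, AEMeasurable (Y t) μ)
    {r σ : ℝ → ℝ} (hr : IsEntropyWeight r) (hσ : IsModulus σ) {γ β p x : ℝ}
    (hp0 : 0 < p) (hp1 : p < 1) (hβ : 0 < β) (hx : 0 ≤ x)
    (hint : IntegrableOn (entropyFun B r σ) (Ioo 0 (β * p)))
    (hγ : ∀ u, ExpBound φ μ (Y u) γ)
    (hinc : ∀ t s, ∀ c, 0 ≤ c → σ (dist t s) ≤ c → ExpBound φ μ (fun ω => Y t ω - Y s ω) c)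
    (δ : ℝ) {S : Set B} (hS : S.Countable) :
    μ {ω | ∃ s ∈ S, δ < |Y s ω|} ≤ ENNReal.ofReal
      (2 * (Real.exp ((1 - p) * φ (γ * x) + p * φ (β * x) - x * (1 - p) * δ) *
        weightInv r (1 / (β * p) * ∫ u in Ioo 0 (β * p), entropyFun B r σ u))) := by
  refine measure_exists_mem_le_of_finset hS fun F => ?_
  rcases F.eq_empty_or_nonempty with rfl | hF
  · simp
  set K := 2 * (Real.exp ((1 - p) * φ (γ * x) + p * φ (β * x)) *
          weightInv r (1 / (β * p) * ∫ u in Ioo 0 (β * p), entropyFun B r σ u)) with hK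
  have hlim : Tendsto (fun m : ℕ => ENNReal.ofReal (Real.exp (p ^ m * Real.log F.card) * K))
      atTop (𝓝 (ENNReal.ofReal (Real.exp (0 * Real.log F.card) * K))) := by
    -- As the chain lengthens, the cost `p ^ m * log F.card` of the last set vanishes.
    refine ENNReal.tendsto_ofReal (Tendsto.mul_const _ ?_)
    exact (Real.continuous_exp.tendsto _).comp
      ((tendsto_pow_atTop_nhds_zero_of_lt_one hp0.le hp1).mul_const _)
  have h := ge_of_tendsto hlim (eventually_atTop.2 ⟨1, fun m hm =>
    finite_tail hφ hY hr hσ hp0 hp1 hβ hx hint hγ hinc δ F hF hm⟩)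
  rw [zero_mul, Real.exp_zero, one_mul] at h
  calc μ {ω | ∃ s ∈ F, δ < |Y s ω|}
      = ENNReal.ofReal (Real.exp (-(x * (1 - p) * δ))) *
        (ENNReal.ofReal (Real.exp (x * (1 - p) * δ)) * μ {ω | ∃ s ∈ F, δ < |Y s ω|}) := by
        rw [← mul_assoc, ← ENNReal.ofReal_mul (Real.exp_pos _).le, ← Real.exp_add]
        simp
    _ ≤ ENNReal.ofReal (Real.exp (-(x * (1 - p) * δ))) * ENNReal.ofReal K := by gcongr
    _ = _ := by
        rw [← ENNReal.ofReal_mul (Real.exp_pos _).le, hK, sub_eq_add_neg (_ + _), Real.exp_add _ (-_)]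
        congr 1
        ring

/-- `x` is the critical point of `A x ^ ζ / ζ - D x`. Since `x ^ (ζ - 1) = D / A`, the hypothesis on
`δ` says `(v x) ^ (ζ - 1) > 1`. -/
theorem exists_optimal_scale {ζ γ β p δ : ℝ} (hζ : 2 ≤ ζ) (hγ : 0 < γ) (hβ : 0 < β)
    (hp0 : 0 < p) (hp1 : p < 1)
    (hδ : (γ ^ ζ * (1 - p) + p * β ^ ζ) / ((1 - p) * min β γ ^ (ζ - 1)) < δ) :
    ∃ x, 0 ≤ x ∧ 1 < γ * x ∧ 1 < β * x ∧
      (1 - p) * ((γ * x) ^ ζ / ζ) + p * ((β * x) ^ ζ / ζ) - x * (1 - p) * δ =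
        -((ζ - 1) * (δ * (1 - p)) ^ (ζ / (ζ - 1)) /
          (ζ * (γ ^ ζ * (1 - p) + p * β ^ ζ) ^ (1 / (ζ - 1)))) := by
  have hp1' : 0 < 1 - p := by linarith
  have hζ1 : 0 < ζ - 1 := by linarith
  have hζ0 : 0 < ζ := by linarith
  set A := γ ^ ζ * (1 - p) + p * β ^ ζ with hA
  have hApos : 0 < A := by positivity
  set v := min β γ with hv
  have hvpos : 0 < v := lt_min hβ hγ
  have hvp : 0 < v ^ (ζ - 1) := Real.rpow_pos_of_pos hvpos _
  have hδ0 : 0 < δ := lt_trans (by positivity) hδ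
  set D := δ * (1 - p) with hD
  have hDpos : 0 < D := by positivity
  set x := (D / A) ^ (1 / (ζ - 1)) with hx
  have hxpos : 0 < x := Real.rpow_pos_of_pos (by positivity) _
  have hxpow : x ^ (ζ - 1) = D / A := by
    rw [hx, ← Real.rpow_mul (by positivity), one_div, inv_mul_cancel₀ hζ1.ne', Real.rpow_one]
  have hvx : 1 < v * x := by
    rw [div_lt_iff₀ (by positivity)] at hδ
    have : 1 < (v * x) ^ (ζ - 1) := by
      rw [Real.mul_rpow hvpos.le hxpos.le, hxpow, mul_div_assoc', one_lt_div hApos]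
      rw [hD]; linarith
    by_contra hcon
    exact absurd this (not_lt.2 (Real.rpow_le_one (by positivity) (not_lt.1 hcon) hζ1.le))
  refine ⟨x, hxpos.le, hvx.trans_le (by gcongr; exact min_le_right _ _),
    hvx.trans_le (by gcongr; exact min_le_left _ _), ?_⟩
  have hxz : x ^ ζ = x * (D / A) := by
    rw [← hxpow, ← Real.rpow_one_add' hxpos.le (by linarith)]
    congr 1; ring
  have hDx : D ^ (ζ / (ζ - 1)) / A ^ (1 / (ζ - 1)) = D * x := by
    rw [show ζ / (ζ - 1) = 1 + 1 / (ζ - 1) by field_simp; ring, Real.rpow_add hDpos,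
      Real.rpow_one, hx, Real.div_rpow hDpos.le hApos.le, mul_div_assoc]
  rw [mul_div_mul_comm, hDx, Real.mul_rpow hγ.le hxpos.le, Real.mul_rpow hβ.le hxpos.le, hxz]
  have hAx : (1 - p) * (γ ^ ζ * (x * (D / A)) / ζ) + p * (β ^ ζ * (x * (D / A)) / ζ)
      = x * D / ζ := by
    have : (1 - p) * (γ ^ ζ * (x * (D / A)) / ζ) + p * (β ^ ζ * (x * (D / A)) / ζ)
      = A * (x * (D / A)) / ζ := by rw [hA]; ring
    rw [this]
    field_simp
  rw [hAx, hD]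
  field_simp
  ring

/-- Near `t` the function `g` is almost constant, so a bound for `|f - g|` on `S` confines `f` to a
closed interval around `g t`, and separability of `f` alone applies. Half the excess over `δ` pays
for the variation of `g`. -/
theorem exists_mem_lt_abs_sub {B : Type*} [PseudoMetricSpace B] {S : Set B} {f g : B → ℝ} {δ : ℝ}
    (hsep : ∀ (G : Set B) (F : Set ℝ), IsOpen G → IsClosed F →
      (∀ s ∈ G ∩ S, f s ∈ F) → ∀ t ∈ G, f t ∈ F)
    (hg : Continuous g) {t : B} (ht : δ < |f t - g t|) : ∃ s ∈ S, δ < |f s - g s| := by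
  set ε := (|f t - g t| - δ) / 2 with hε
  have hε0 : 0 < ε := by rw [hε]; linarith
  by_contra! hcon
  have hG : IsOpen {s | |g s - g t| < ε} := isOpen_lt (by fun_prop) continuous_const
  have hF : IsClosed {y : ℝ | |y - g t| ≤ δ + ε} := isClosed_le (by fun_prop) continuous_const
  have := hsep _ _ hG hF (fun s hs => by
    have h1 : |g s - g t| < ε := hs.1
    have h2 := hcon s hs.2
    have h3 := abs_sub_le (f s) (g s) (g t)
    change |f s - g t| ≤ δ + ε
    linarith) t (by simpa using hε0)
  change |f t - g t| ≤ δ + ε at this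
  linarith

/-! ### Consequences of the increment bounds. -/

theorem IncrementBound.tau_le_modulus {Ω B : Type*} [MeasurableSpace Ω] [PseudoMetricSpace B]
    {φ : ℝ → ℝ} {μ : Measure Ω} {X : B → Ω → ℝ} {σ : ℝ → ℝ} (h : IncrementBound φ μ X σ)
    (hσ : IsModulus σ) (t s : B) : tau φ μ (fun ω => X t ω - X s ω) ≤ σ (dist t s) := by
  rcases (dist_nonneg (x := t) (y := s)).eq_or_lt with h0 | h0
  -- Distinct points of a pseudometric space may be at distance `0`, where the bound is reached only
  -- as `h → 0`.
  · have hc : Tendsto σ (𝓝[>] 0) (𝓝 (σ 0)) :=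
      (hσ.continuousOn 0 self_mem_Ici).tendsto.mono_left (nhdsWithin_mono _ Ioi_subset_Ici_self)
    rw [← h0]
    refine ge_of_tendsto hc ?_
    filter_upwards [self_mem_nhdsWithin] with d (hd : 0 < d) using h d hd t s (h0 ▸ hd.le)
  · exact h _ h0 t s le_rfl

theorem IsModulus.nonneg {σ : ℝ → ℝ} (hσ : IsModulus σ) {h : ℝ} (hh : 0 ≤ h) : 0 ≤ σ h :=
  hσ.map_zero ▸ hσ.monotoneOn self_mem_Ici hh hh

section Increments

variable {Ω B : Type*} [MeasurableSpace Ω] [PseudoMetricSpace B] {φ : ℝ → ℝ} {μ : Measure Ω}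
  {X Y : B → Ω → ℝ} {σ τ : ℝ → ℝ}

/-- Without boundedness the real supremum defining `γN` would default to `0`. Compactness bounds
every increment from a fixed point by `σ` of the diameter. -/
theorem IsSubProcess.bddAbove_tau [CompactSpace B] (hφ : IsOrliczN φ) (hX : IsSubProcess φ μ X)
    (hσ : IsModulus σ) (h : IncrementBound φ μ X σ) :
    BddAbove (range fun u => tau φ μ (X u)) := by
  rcases isEmpty_or_nonempty B with hB | ⟨⟨s⟩⟩
  · simp [range_eq_empty]
  refine ⟨σ (Metric.diam (univ : Set B)) + tau φ μ (X s), ?_⟩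
  rintro _ ⟨t, rfl⟩
  have hd : dist t s ≤ Metric.diam (univ : Set B) :=
    Metric.dist_le_diam_of_mem isCompact_univ.isBounded (mem_univ _) (mem_univ _)
  have h1 : ExpBound φ μ (fun ω => X t ω - X s ω) (σ (Metric.diam (univ : Set B))) :=
    ((hX t).sub hφ (hX s)).expBound hφ
      ((h.tau_le_modulus hσ t s).trans (hσ.monotoneOn dist_nonneg Metric.diam_nonneg hd))
  have h2 : ExpBound φ μ (X s) (tau φ μ (X s)) := (hX s).expBound hφ le_rfl
  have h0 := hσ.nonneg (Metric.diam_nonneg (s := (univ : Set B)))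
  have := h1.add hφ ((hX t).sub hφ (hX s)).1 (hX s).1 h0 tau_nonneg h2
  simp only [sub_add_cancel] at this
  exact tau_le (add_nonneg h0 tau_nonneg) this

/-- An increment of `Y` is the increment of `X` minus that of `X - Y`, so its `L¹` norm is at most a
constant times `σ + τ` at the distance. -/
theorem tendsto_lintegral_enorm_sub (hφ : IsOrliczN φ) (hX : IsSubProcess φ μ X)
    (hY : IsSubProcess φ μ Y) (hσ : IsModulus σ) (hτ : IsModulus τ)
    (h : IncrementBound φ μ X σ) (h' : IncrementBound φ μ (fun t ω => X t ω - Y t ω) τ) (t : B) :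
    Tendsto (fun s => ∫⁻ ω, ‖Y s ω - Y t ω‖ₑ ∂μ) (𝓝 t) (𝓝 0) := by
  have hle : ∀ s, ∫⁻ ω, ‖Y s ω - Y t ω‖ₑ ∂μ ≤
      ENNReal.ofReal ((σ (dist s t) + τ (dist s t)) * (2 * Real.exp (φ 1))) := fun s => by
    have hZ : ∀ u, IsSub φ μ (fun ω => X u ω - Y u ω) := fun u => (hX u).sub hφ (hY u)
    have hXb := ((hX s).sub hφ (hX t)).expBound hφ (h.tau_le_modulus hσ s t)
    have hZb := ((hZ s).sub hφ (hZ t)).expBound hφ (h'.tau_le_modulus hτ s t)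
    have hb := hXb.sub hφ ((hX s).sub hφ (hX t)).1 ((hZ s).sub hφ (hZ t)).1
      (hσ.nonneg dist_nonneg) (hτ.nonneg dist_nonneg) hZb
    have e : (fun ω => X s ω - X t ω - (X s ω - Y s ω - (X t ω - Y t ω)))
        = fun ω => Y s ω - Y t ω := by ext ω; ring
    rw [e] at hb
    exact hb.lintegral_enorm_le hφ ((hY s).1.sub (hY t).1)
      (add_nonneg (hσ.nonneg dist_nonneg) (hτ.nonneg dist_nonneg))
  refine tendsto_of_tendsto_of_tendsto_of_le_of_le tendsto_const_nhds ?_ (fun _ => zero_le) hle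
  have hcomp : ∀ {σ : ℝ → ℝ}, IsModulus σ → Continuous fun s => σ (dist s t) := fun hσ =>
    hσ.continuousOn.comp_continuous (by fun_prop) fun s => mem_Ici.2 dist_nonneg
  have hc : Continuous fun s =>
      ENNReal.ofReal ((σ (dist s t) + τ (dist s t)) * (2 * Real.exp (φ 1))) :=
    ENNReal.continuous_ofReal.comp (((hcomp hσ).add (hcomp hτ)).mul continuous_const)
  simpa [hσ.map_zero, hτ.map_zero] using hc.tendsto t

theorem IsSub.integrable (hφ : IsOrliczN φ) {ξ : Ω → ℝ} (h : IsSub φ μ ξ) : Integrable ξ μ :=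
  ⟨h.1.aestronglyMeasurable, ((h.expBound hφ le_rfl).lintegral_enorm_le hφ h.1
    tau_nonneg).trans_lt ENNReal.ofReal_lt_top⟩

theorem ae_eq_zero_of_expBound_zero (hφ : IsOrliczN φ) {ξ : Ω → ℝ} (hξ : AEMeasurable ξ μ)
    (h : ExpBound φ μ ξ 0) : ∀ᵐ ω ∂μ, ξ ω = 0 := by
  have := h.lintegral_enorm_le hφ hξ le_rfl
  rw [zero_mul, ENNReal.ofReal_zero, nonpos_iff_eq_zero, lintegral_eq_zero_iff' hξ.enorm] at this
  filter_upwards [this] with ω hω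
  simpa using hω

end Increments

end PhiSub

/-! ### The approximation theorem. -/

open PhiSub
theorem theorem4 {Ω B : Type*} [MeasurableSpace Ω] (μ : Measure Ω) [IsProbabilityMeasure μ]
    [PseudoMetricSpace B] [CompactSpace B] [Nonempty B]
    (φ : ℝ → ℝ) (ζ : ℝ) (hφ : ClassI ζ φ)
    (X XN : B → Ω → ℝ) (N : ℕ) (hmodel : IsModel μ N X XN)
    (σ r : ℝ → ℝ) (β : ℝ) (hX : EntropyConditions φ μ X σ r β)
    (hXN : IsSubProcess φ μ XN)
    (σN : ℝ → ℝ) (hσN : IsModulus σN)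
    (hΔ : IncrementBound φ μ (fun t ω => X t ω - XN t ω) σN)
    (p : ℝ) (hp0 : 0 < p) (hp1 : p < 1)
    (hint : IntegrableOn (entropyFun B r σN) (Ioo 0 (β * p)))
    (γN : ℝ) (hγN : γN = ⨆ u : B, tau φ μ (fun ω => X u ω - XN u ω))
    (ν δ : ℝ)
    (hν : 2 * tailBound B r σN ζ γN β p δ ≤ ν)
    (hδ : (γN ^ ζ * (1 - p) + p * β ^ ζ) / ((1 - p) * min β γN ^ (ζ - 1)) < δ) :
    Approximates μ X XN ν δ := by
  have hφN : IsOrliczN φ := hφ.toIsOrliczN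
  have hβ := hX.beta_pos
  have hp1' : 0 < 1 - p := by linarith
  have hZ : IsSubProcess φ μ (fun t ω => X t ω - XN t ω) := fun u => (hX.sub u).sub hφN (hXN u)
  have hbdd := hZ.bddAbove_tau hφN hσN hΔ
  have hγ : ∀ u, ExpBound φ μ (fun ω => X u ω - XN u ω) γN := fun u =>
    (hZ u).expBound hφN (hγN ▸ le_ciSup hbdd u)
  have hγ0 : 0 ≤ γN := hγN ▸ Real.iSup_nonneg fun _ => tau_nonneg
  have hδ0 : 0 < δ := lt_of_le_of_lt
    (by have := Real.rpow_nonneg (le_min hβ.le hγ0) (ζ - 1); positivity) hδ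
  have hpaths : ∀ᵐ ω ∂μ, Continuous fun t => XN t ω := by
    obtain ⟨ξ, a, -, -, hXNeq⟩ := hmodel
    refine ae_continuous_of_finite_sum (n := N + 1) (fun i => ξ i) (fun t i => a i t)
      (fun t ω => ?_) (fun t => (hXN t).integrable hφN)
      (tendsto_lintegral_enorm_sub hφN hX.sub hXN hX.modulus hσN hX.increments hΔ)
    rw [hXNeq, Finset.sum_range]
    simp only [dotProduct, mul_comm]
  obtain ⟨S, hSc, -, hsep⟩ := hX.separable
  have hS : μ {ω | ENNReal.ofReal δ < ⨆ t : B, ‖X t ω - XN t ω‖ₑ}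
      ≤ μ {ω | ∃ s ∈ S, δ < |X s ω - XN s ω|} := by
    refine measure_mono_ae ?_
    filter_upwards [hpaths, hsep] with ω hc hs hω
    obtain ⟨t, ht⟩ := lt_iSup_iff.1 hω
    rw [Real.enorm_eq_ofReal_abs, ENNReal.ofReal_lt_ofReal_iff_of_nonneg hδ0.le] at ht
    exact exists_mem_lt_abs_sub hs hc ht
  refine hS.trans ?_
  -- If `γN = 0`, the quotient in `hδ` is `0` by division by zero, no scale `x` is available, and
  -- the error vanishes almost surely on `S`.
  rcases hγ0.eq_or_lt with h0 | hγpos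
  · have hz : ∀ᵐ ω ∂μ, ∀ s ∈ S, X s ω - XN s ω = 0 := (ae_ball_iff hSc).2 fun s _ =>
      ae_eq_zero_of_expBound_zero hφN (hZ s).1 (h0 ▸ hγ s)
    have : μ {ω | ∃ s ∈ S, δ < |X s ω - XN s ω|} = 0 := by
      refine measure_eq_zero_iff_ae_notMem.2 ?_
      filter_upwards [hz] with ω hω
      rintro ⟨s, hs, hlt⟩
      rw [hω s hs, abs_zero] at hlt
      exact hδ0.not_gt hlt
    rw [this]
    exact zero_le
  obtain ⟨x, hx0, hγx, hβx, hopt⟩ := exists_optimal_scale hφ.two_le hγpos hβ hp0 hp1 hδ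
  have htail := entropy_tail hφN (fun t => (hZ t).1) hX.weight hσN hp0 hp1 hβ hx0 hint hγ
    (fun t s c _ hc => ((hZ t).sub hφN (hZ s)).expBound hφN ((hΔ.tau_le_modulus hσN t s).trans hc))
    δ hSc
  rw [hφ.eq_rpow _ hγx, hφ.eq_rpow _ hβx, hopt] at htail
  exact htail.trans (ENNReal.ofReal_le_ofReal hν)
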